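/- All groups are finite. For a group $G$ let $\Phi(G)$ be the Frattini subgroup (the intersection of all maximal subgroups of $G$, equal to $G$ if $G=1$) and $\mathrm{Soc}(G)$ the socle (the subgroup generated by all minimal normal subgroups of $G$). $G$ is called quasinilpotent if every element of $G$ induces by conjugation an inner automorphism on every chief factor $H/K$ of $G$. Let $\tilde F(G)$ be the subgroup of $G$ with $\Phi(G)\subseteq\tilde F(G)$ and $\tilde F(G)/\Phi(G)=\mathrm{Soc}(G/\Phi(G))$; put $\tilde F^0(G)=G$, $\tilde F^{n}(G)=\tilde F(\tilde F^{n-1}(G))$ for $n\ge 1$, and let $\tilde F^\infty(G)$ be the smallest member of the descending series $G=\tilde F^0(G)\supseteq\tilde F^1(G)\supseteq\cdots$. Let $\widehat{\mathfrak N^*}$ be the class of all groups $H$ with $\tilde F(H)=H$, and let $G_{\widehat{\mathfrak N^*}}$ be the subgroup of $G$ generated by all normal subgroups of $G$ that belong to $\widehat{\mathfrak N^*}$. Proposition 5.2. Let $G$ be a finite group. Then $G_{\widehat{\mathfrak N^*}}=\tilde F^\infty(G)$, and this subgroup is the largest normal subgroup of $G$ that belongs to $\widehat{\mathfrak N^*}$.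 Moreover, $\tilde F^\infty(G)$ is the largest normal subgroup $N$ of $G$ such that $N/\Phi(N)$ is quasinilpotent. In both cases "largest" means that $\tilde F^\infty(G)$ is itself such a normal subgroup of $G$ and contains every other one. -/

import Mathlib

universe u

namespace GenFitting

/-- `N` is a minimal normal subgroup of `G`. -/
def IsMinimalNormal {G : Type u} [Group G] (N : Subgroup G) : Prop :=
  N.Normal ∧ N ≠ ⊥ ∧ ∀ K : Subgroup G, K.Normal → K ≤ N → K = ⊥ ∨ K = N

/-- The socle: the subgroup generated by all minimal normal subgroups. -/
def socle (G : Type u) [Group G] : Subgroup G :=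
  sSup {N : Subgroup G | IsMinimalNormal N}

/-- `H / K` is a chief factor of `G`. -/
def IsChiefFactor {G : Type u} [Group G] (H K : Subgroup G) : Prop :=
  H.Normal ∧ K.Normal ∧ K < H ∧
    ∀ L : Subgroup G, L.Normal → K ≤ L → L ≤ H → L = K ∨ L = H

/-- `G` is quasinilpotent: every element `g` of `G` induces (by conjugation) an inner automorphism
on every chief factor `H / K` of `G`, i.e. there is `h ∈ H` such that `g x g⁻¹` and `h x h⁻¹` are
congruent modulo `K` for all `x ∈ H`. -/
def IsQuasinilpotent (G : Type u) [Group G] : Prop :=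
  ∀ H K : Subgroup G, IsChiefFactor H K →
    ∀ g : G, ∃ h ∈ H, ∀ x ∈ H, (h * x * h⁻¹)⁻¹ * (g * x * g⁻¹) ∈ K

/-- The generalized Fitting subgroup `F̃(G)`: the full preimage in `G` of `Soc(G / Φ(G))`. -/
def fTilde (G : Type u) [Group G] : Subgroup G :=
  (socle (G ⧸ frattini G)).comap (QuotientGroup.mk' (frattini G))

/-- `F̃(G)` contains `Φ(G)`. -/
theorem frattini_le_fTilde (G : Type u) [Group G] : frattini G ≤ fTilde G := by
  intro x hx
  have h : QuotientGroup.mk' (frattini G) x = 1 := (QuotientGroup.eq_one_iff x).2 hx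
  rw [fTilde, Subgroup.mem_comap, h]
  exact Subgroup.one_mem _

/-- `F̃(G) / Φ(G) = Soc(G / Φ(G))`. -/
theorem map_fTilde (G : Type u) [Group G] :
    (fTilde G).map (QuotientGroup.mk' (frattini G)) = socle (G ⧸ frattini G) :=
  Subgroup.map_comap_eq_self_of_surjective (QuotientGroup.mk'_surjective _) _

/-- `F̃⁰(G) = G` and `F̃ⁿ⁺¹(G) = F̃(F̃ⁿ(G))`, all regarded as subgroups of `G`. -/
def fTildeIter (G : Type u) [Group G] : ℕ → Subgroup G
  | 0 => ⊤
  | n + 1 => (fTilde (fTildeIter G n)).map (fTildeIter G n).subtype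

/-- `F̃^∞(G)`: the smallest member of the descending series `F̃⁰(G) ≥ F̃¹(G) ≥ ⋯`. -/
def fTildeInf (G : Type u) [Group G] : Subgroup G :=
  ⨅ n, fTildeIter G n

/-- The series is descending. -/
theorem fTildeIter_antitone (G : Type u) [Group G] : Antitone (fTildeIter G) :=
  antitone_nat_of_succ_le fun n => Subgroup.map_subtype_le (fTilde (fTildeIter G n))

/-- For a finite group the series does have a smallest member. -/
theorem exists_fTildeInf_eq (G : Type u) [Group G] [Finite G] :
    ∃ n, fTildeInf G = fTildeIter G n := by
  obtain ⟨n, hn⟩ := WellFoundedGT.monotone_chain_condition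
    (OrderHom.mk (fun n => OrderDual.toDual (fTildeIter G n)) (fTildeIter_antitone G).dual_right)
  refine ⟨n, le_antisymm (iInf_le _ n) (le_iInf fun m => ?_)⟩
  rcases le_total n m with h | h
  · exact (OrderDual.toDual.injective (hn m h)).le
  · exact fTildeIter_antitone G h

/-- The `𝔉`-radical of `G` for a class `𝔉` of groups: the subgroup generated by all normal subgroups
of `G` that belong to `𝔉`. -/
def classRadical (𝔉 : (H : Type u) → [Group H] → Prop) (G : Type u) [Group G] : Subgroup G :=
  sSup {N : Subgroup G | N.Normal ∧ 𝔉 N}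

/-- Membership in Förster's class of groups `H` with `F̃(H) = H`. -/
def ForsterClass (H : Type u) [Group H] : Prop :=
  fTilde H = ⊤

end GenFitting

/-! Call a group centrally reducible if `T * C(T)` is everything for each normal `T`. A finite group
equal to its socle has this property, and the property implies quasinilpotency. A finite
quasinilpotent group with trivial Frattini subgroup equals its socle, so the class condition on `H`
says exactly that `H/Φ(H)` is quasinilpotent. Central reducibility passes to images. If `N` is
normal in `G` and lies in the class, then `Φ(N) ≤ Φ(G)`, so the image of `N` in `G/Φ(G)` is a
quotient of `N/Φ(N)`; `le_socle_of_frattini_eq_bot` puts it in the socle, i.e. `N ≤ F̃(G)`.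
Iterating, `N` lies in every term of the series. The series becomes stationary, so its last term is
itself in the class. -/

namespace GenFitting

section Auxiliary

variable {G : Type u} [Group G]

/-- Every normal subgroup, together with its centralizer, generates the whole group. -/
def IsCentrallyReducible (G : Type u) [Group G] : Prop :=
  ∀ T : Subgroup G, T.Normal → T ⊔ Subgroup.centralizer (T : Set G) = ⊤

/-! ### Invariance of the socle and of `F̃`. -/

theorem IsMinimalNormal.map_mulEquiv {H : Type u} [Group H] {N : Subgroup G}
    (hN : IsMinimalNormal N) (e : G ≃* H) : IsMinimalNormal (N.map e.toMonoidHom) := by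
  obtain ⟨hn, hb, hm⟩ := hN
  refine ⟨hn.map _ e.surjective, ?_, ?_⟩
  · rwa [Ne, Subgroup.map_eq_bot_iff_of_injective _ e.injective]
  · intro K hK hKN
    have hback : (K.comap e.toMonoidHom).map e.toMonoidHom = K :=
      Subgroup.map_comap_eq_self_of_surjective e.surjective K
    rcases hm (K.comap e.toMonoidHom) (hK.comap _) (by
      rw [← Subgroup.map_le_map_iff_of_injective (f := e.toMonoidHom) e.injective, hback]
      exact hKN) with h | h
    · left; rw [← hback, h, Subgroup.map_bot]
    · right; rw [← hback, h]

theorem map_socle_le {H : Type u} [Group H] (e : G ≃* H) :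
    (socle G).map e.toMonoidHom ≤ socle H := by
  rw [Subgroup.map_le_iff_le_comap]
  refine sSup_le fun N hN => ?_
  rw [← Subgroup.map_le_iff_le_comap]
  exact le_sSup (hN.map_mulEquiv e)

instance socle_normal : (socle G).Normal := by
  refine ⟨fun x hx g => ?_⟩
  exact map_socle_le (MulAut.conj g) ⟨x, hx, rfl⟩

instance fTilde_characteristic : (fTilde G).Characteristic := by
  rw [Subgroup.characteristic_iff_map_le]
  rintro φ _ ⟨x, hx, rfl⟩
  have h := Subgroup.characteristic_iff_map_eq.1 (inferInstance : (frattini G).Characteristic) φ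
  exact map_socle_le (QuotientGroup.congr (frattini G) (frattini G) φ h) ⟨_, hx, rfl⟩

instance fTildeIter_normal (n : ℕ) : (fTildeIter G n).Normal := by
  induction n with
  | zero => exact Subgroup.normal_top
  | succ n ih =>
    exact ConjAct.normal_of_characteristic_of_normal

theorem exists_isMinimalNormal_le [Finite G] {H : Subgroup G} (hH : H.Normal) (hb : H ≠ ⊥) :
    ∃ N, IsMinimalNormal N ∧ N ≤ H := by
  obtain ⟨N, hNH, hN⟩ := exists_minimal_le_of_wellFoundedLT
    (fun K : Subgroup G => K.Normal ∧ K ≠ ⊥) H ⟨hH, hb⟩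
  refine ⟨N, ⟨hN.1.1, hN.1.2, fun K hK hKN => ?_⟩, hNH⟩
  by_cases h : K = ⊥
  · exact Or.inl h
  · exact Or.inr (le_antisymm hKN (hN.2 ⟨hK, h⟩ hKN))

/-! ### Central reducibility. -/

/-- In a group generated by its minimal normal subgroups, every normal subgroup has a normal
complement, which centralizes it. -/
theorem isCentrallyReducible_of_socle_eq_top [Finite G] (h : socle G = ⊤) :
    IsCentrallyReducible G := by
  intro T hT
  obtain ⟨B, -, hB⟩ := exists_maximal_ge_of_wellFoundedGT
    (fun K : Subgroup G => K.Normal ∧ Disjoint K T) ⊥ ⟨inferInstance, disjoint_bot_left⟩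
  obtain ⟨hBn, hBT⟩ := hB.1
  have hBC : B ≤ Subgroup.centralizer (T : Set G) := fun b hb t ht =>
    (Subgroup.commute_of_normal_of_disjoint B T hBn hT hBT b t hb ht).symm
  refine top_le_iff.1 ?_
  rw [← h]
  refine sSup_le fun N hN => le_trans ?_ (sup_le_sup_left hBC T)
  have hNn : N.Normal := hN.1
  rcases hN.2.2 (N ⊓ (T ⊔ B)) inferInstance inf_le_left with h0 | h0
  -- If `N` meets `TB` trivially, then `BN` still meets `T` trivially, because `bn ∈ T` forces `n ∈
  -- TB`. Maximality of `B` applies.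
  · have hmem : N ≤ B := by
      refine le_trans le_sup_right (hB.2 (y := B ⊔ N) ⟨inferInstance, ?_⟩ le_sup_left)
      rw [Subgroup.disjoint_def]
      intro x hx hxT
      obtain ⟨b, hb, n, hn, rfl⟩ := Subgroup.mem_sup_of_normal_right.1 hx
      have hn1 : n ∈ N ⊓ (T ⊔ B) := by
        refine ⟨hn, ?_⟩
        have := mul_mem ((le_sup_right : B ≤ T ⊔ B) (inv_mem hb))
          ((le_sup_left : T ≤ T ⊔ B) hxT)
        simpa using this
      rw [h0, Subgroup.mem_bot] at hn1
      subst hn1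
      rw [mul_one] at hxT ⊢
      exact Subgroup.disjoint_def.1 hBT hb hxT
    exact hmem.trans le_sup_right
  · exact inf_eq_left.1 h0

/-- Used for the image of `N/Φ(N)` in `G/Φ(G)`, where `f` is not surjective. -/
theorem IsCentrallyReducible.range_le {H : Type u} [Group H] (hG : IsCentrallyReducible G)
    (f : G →* H) {T : Subgroup H} (hT : T.Normal) (hTf : T ≤ f.range) :
    f.range ≤ T ⊔ Subgroup.centralizer (T : Set H) := by
  rintro _ ⟨x, rfl⟩
  have hx : x ∈ T.comap f ⊔ Subgroup.centralizer (T.comap f : Set G) := by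
    rw [hG _ (hT.comap f)]; trivial
  obtain ⟨t, ht, c, hc, rfl⟩ := Subgroup.mem_sup_of_normal_left.1 hx
  rw [map_mul]
  refine Subgroup.mul_mem_sup ht fun y hy => ?_
  obtain ⟨z, rfl⟩ := hTf hy
  rw [← map_mul, ← map_mul, hc z hy]

theorem IsCentrallyReducible.of_surjective {H : Type u} [Group H] (hG : IsCentrallyReducible G)
    (f : G →* H) (hf : Function.Surjective f) : IsCentrallyReducible H := by
  intro T hT
  have h := MonoidHom.range_eq_top.2 hf
  exact top_le_iff.1 (h ▸ hG.range_le f hT (h ▸ le_top))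

theorem IsCentrallyReducible.isQuasinilpotent (hG : IsCentrallyReducible G) :
    IsQuasinilpotent G := by
  intro H K hHK g
  have hHn : H.Normal := hHK.1
  have hg : g ∈ H ⊔ Subgroup.centralizer (H : Set G) := by rw [hG H hHn]; trivial
  obtain ⟨h, hh, c, hc, rfl⟩ := Subgroup.mem_sup_of_normal_left.1 hg
  refine ⟨h, hh, fun x hx => ?_⟩
  have : (h * x * h⁻¹)⁻¹ * (h * c * x * (h * c)⁻¹) = 1 := by
    rw [mul_assoc h c x, ← hc x hx]; group
  rw [this]
  exact one_mem K

theorem exists_isCoatom_not_le {P : Subgroup G} (hP : ¬ P ≤ frattini G) :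
    ∃ L : Subgroup G, IsCoatom L ∧ ¬ P ≤ L := by
  by_contra! h
  exact hP (le_iInf₂ h)

/-! ### Groups with trivial Frattini subgroup. -/

/-- An abelian normal subgroup meeting the Frattini subgroup trivially has a complement. -/
theorem exists_complement_of_frattini_eq_bot [Finite G] (hΦ : frattini G = ⊥) {A : Subgroup G}
    (hA : A.Normal) (hcomm : A ≤ Subgroup.centralizer (A : Set G)) :
    ∃ U : Subgroup G, A ⊔ U = ⊤ ∧ A ⊓ U = ⊥ := by
  obtain ⟨U, -, hU⟩ := exists_minimal_le_of_wellFoundedLT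
    (fun K : Subgroup G => A ⊔ K = ⊤) ⊤ (by simp)
  refine ⟨U, hU.1, ?_⟩
  -- `U` normalizes `A ⊓ U` and the abelian group `A` centralizes it.
  have hn : (A ⊓ U).Normal := by
    refine ⟨fun x hx g => ?_⟩
    have hg : g ∈ A ⊔ U := by rw [hU.1]; trivial
    obtain ⟨a, ha, u, hu, rfl⟩ := Subgroup.mem_sup_of_normal_left.1 hg
    have hy : u * x * u⁻¹ ∈ A ⊓ U :=
      ⟨hA.conj_mem x hx.1 u, U.mul_mem (U.mul_mem hu hx.2) (U.inv_mem hu)⟩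
    have : a * u * x * (a * u)⁻¹ = u * x * u⁻¹ := by
      have h1 := hcomm ha _ hy.1
      calc a * u * x * (a * u)⁻¹ = a * (u * x * u⁻¹) * a⁻¹ := by group
        _ = u * x * u⁻¹ := by rw [← h1]; group
    rwa [this]
  rw [← le_bot_iff, ← hΦ]
  by_contra hle
  obtain ⟨L, hL, hAL⟩ := exists_isCoatom_not_le hle
  have htop : A ⊓ U ⊔ L = ⊤ := hL.2 _ (right_lt_sup.2 hAL)
  -- By Dedekind's law `U = (A ⊓ U)(U ⊓ L)`, so `U ⊓ L` also supplements `A`, against the minimality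
  -- of `U`.
  have hUL : A ⊔ U ⊓ L = ⊤ := by
    rw [← top_le_iff, ← hU.1]
    refine sup_le le_sup_left fun u hu => ?_
    have hu' : u ∈ A ⊓ U ⊔ L := by rw [htop]; trivial
    obtain ⟨a, ha, l, hl, rfl⟩ := Subgroup.mem_sup_of_normal_left.1 hu'
    exact Subgroup.mul_mem_sup ha.1 ⟨(Subgroup.mul_mem_cancel_left _ ha.2).1 hu, hl⟩
  exact hAL (inf_le_right.trans ((hU.2 (y := U ⊓ L) hUL inf_le_left).trans inf_le_right))

/-- With `S = M ⊓ socle G` and `C = C_M(S)`, the abelian group `S ⊓ C` has a complement `U`. Then `C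
⊓ U` is normal in `G`, and a minimal normal subgroup inside it would lie in `S ⊓ C ⊓ U = 1`. Hence
`C ≤ S` and `M = SC = S`. -/
theorem le_socle_of_frattini_eq_bot [Finite G] (hΦ : frattini G = ⊥) {M : Subgroup G}
    (hM : M.Normal)
    (h : M ≤ (M ⊓ socle G) ⊔ Subgroup.centralizer ((M ⊓ socle G : Subgroup G) : Set G)) :
    M ≤ socle G := by
  set S := M ⊓ socle G with hS
  have hSn : S.Normal := inferInstance
  set C := M ⊓ Subgroup.centralizer (S : Set G) with hC
  have hCn : C.Normal := inferInstance
  obtain ⟨U, hAU, hAU'⟩ := exists_complement_of_frattini_eq_bot hΦ (A := S ⊓ C) inferInstance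
    (fun a ha b hb => ha.2.2 b hb.1)
  have hn : (C ⊓ U).Normal := by
    refine ⟨fun x hx g => ?_⟩
    have hg : g ∈ U ⊔ S ⊓ C := by rw [sup_comm, hAU]; trivial
    obtain ⟨u, hu, a, ha, rfl⟩ := Subgroup.mem_sup_of_normal_right.1 hg
    have : u * a * x * (u * a)⁻¹ = u * x * u⁻¹ := by
      rw [mul_assoc u a x, hx.1.2 a ha.1]; group
    rw [this]
    exact ⟨hCn.conj_mem x hx.1 u, U.mul_mem (U.mul_mem hu hx.2) (U.inv_mem hu)⟩
  have hCU : C ⊓ U = ⊥ := by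
    by_contra hne
    obtain ⟨N, hN, hNC⟩ := exists_isMinimalNormal_le hn hne
    have hNS : N ≤ S := le_inf ((hNC.trans inf_le_left).trans inf_le_left) (le_sSup hN)
    refine hN.2.1 (le_bot_iff.1 ?_)
    rw [← hAU']
    exact le_inf (le_inf hNS (hNC.trans inf_le_left)) (hNC.trans inf_le_right)
  have hCS : C ≤ S := by
    intro c hc
    have hc' : c ∈ S ⊓ C ⊔ U := by rw [hAU]; trivial
    obtain ⟨a, ha, u, hu, rfl⟩ := Subgroup.mem_sup_of_normal_left.1 hc'
    have hu1 : u ∈ C ⊓ U := ⟨(Subgroup.mul_mem_cancel_left _ ha.2).1 hc, hu⟩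
    rw [hCU, Subgroup.mem_bot] at hu1
    rw [hu1, mul_one]
    exact ha.1
  intro m hm
  obtain ⟨s, hs, c, hc, rfl⟩ := Subgroup.mem_sup_of_normal_left.1 (h hm)
  exact mul_mem hs.2 (hCS ⟨(Subgroup.mul_mem_cancel_left _ hs.1).1 hm, hc⟩).2

/-! ### Quasinilpotent groups and their socle. -/

theorem IsMinimalNormal.isChiefFactor {N : Subgroup G} (hN : IsMinimalNormal N) :
    IsChiefFactor N ⊥ :=
  ⟨hN.1, inferInstance, bot_lt_iff_ne_bot.2 hN.2.1, fun L hL _ hLN => hN.2.2 L hL hLN⟩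

theorem IsQuasinilpotent.sup_centralizer_of_isMinimalNormal (hG : IsQuasinilpotent G)
    {N : Subgroup G} (hN : IsMinimalNormal N) :
    N ⊔ Subgroup.centralizer (N : Set G) = ⊤ := by
  refine top_le_iff.1 fun g _ => ?_
  obtain ⟨h, hh, hx⟩ := hG N ⊥ hN.isChiefFactor g
  have : h⁻¹ * g ∈ Subgroup.centralizer (N : Set G) := by
    intro x hxN
    have h1 := hx x hxN
    rw [Subgroup.mem_bot, inv_mul_eq_one] at h1
    calc x * (h⁻¹ * g) = h⁻¹ * (h * x * h⁻¹) * g := by group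
      _ = h⁻¹ * (g * x * g⁻¹) * g := by rw [h1]
      _ = h⁻¹ * g * x := by group
  simpa using Subgroup.mul_mem_sup hh this

theorem IsQuasinilpotent.socle_sup_centralizer [Finite G] (hG : IsQuasinilpotent G) :
    socle G ⊔ Subgroup.centralizer (socle G : Set G) = ⊤ := by
  obtain ⟨T, -, hT⟩ := exists_maximal_ge_of_wellFoundedGT
    (fun K : Subgroup G => K.Normal ∧ K ≤ socle G ∧ K ⊔ Subgroup.centralizer (K : Set G) = ⊤) ⊥
    ⟨inferInstance, bot_le, top_le_iff.1 fun g _ =>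
      (le_sup_right : _ ≤ ⊥ ⊔ Subgroup.centralizer ((⊥ : Subgroup G) : Set G))
        fun x hx => by rw [Subgroup.mem_bot.1 hx]; simp⟩
  obtain ⟨hTn, hTs, hTC⟩ := hT.1
  have key : socle G ≤ T := by
    refine sSup_le fun N hN => ?_
    have hNn : N.Normal := hN.1
    rcases hN.2.2 (N ⊓ T) inferInstance inf_le_left with h0 | h0
    · refine le_trans le_sup_right (hT.2 (y := T ⊔ N)
        ⟨inferInstance, sup_le hTs (le_sSup hN), ?_⟩ le_sup_left)
      have hd : Disjoint N T := disjoint_iff.2 h0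
      refine top_le_iff.1 fun q _ => ?_
      have hq : q ∈ T ⊔ Subgroup.centralizer (T : Set G) := by rw [hTC]; trivial
      obtain ⟨t, ht, c, hc, rfl⟩ := Subgroup.mem_sup_of_normal_left.1 hq
      have hc' : c ∈ N ⊔ Subgroup.centralizer (N : Set G) := by
        rw [hG.sup_centralizer_of_isMinimalNormal hN]; trivial
      obtain ⟨n, hn, d, hd', rfl⟩ := Subgroup.mem_sup_of_normal_left.1 hc'
      -- Both `c` and `n` centralize `T`, hence so does `d = n⁻¹c`; thus `d` centralizes `TN`.
      have hnT : n ∈ Subgroup.centralizer (T : Set G) := fun x hx =>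
        (Subgroup.commute_of_normal_of_disjoint N T hNn hTn hd n x hn hx).symm
      have hdT : d ∈ Subgroup.centralizer (T : Set G) := by
        simpa using mul_mem (inv_mem hnT) hc
      rw [← mul_assoc]
      refine Subgroup.mul_mem_sup (Subgroup.mul_mem_sup ht hn) fun x hx => ?_
      obtain ⟨y, hy, z, hz, rfl⟩ := Subgroup.mem_sup_of_normal_left.1 hx
      rw [mul_assoc, hd' z hz, ← mul_assoc, hdT y hy, mul_assoc]
    · exact inf_eq_left.1 h0
  rw [le_antisymm key hTs, hTC]

theorem IsQuasinilpotent.socle_eq_top [Finite G] (hG : IsQuasinilpotent G)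
    (hΦ : frattini G = ⊥) : socle G = ⊤ := by
  refine top_le_iff.1 (le_socle_of_frattini_eq_bot hΦ inferInstance ?_)
  rw [top_inf_eq, hG.socle_sup_centralizer]

/-! ### Frattini subgroups of quotients and of normal subgroups. -/

theorem frattini_quotient_frattini : frattini (G ⧸ frattini G) = ⊥ := by
  rw [← le_bot_iff]
  intro x hx
  obtain ⟨g, rfl⟩ := QuotientGroup.mk'_surjective (frattini G) x
  refine Subgroup.mem_bot.2 ((QuotientGroup.eq_one_iff g).2 ?_)
  by_contra hg
  obtain ⟨L, hL, hgL⟩ := exists_isCoatom_not_le (P := Subgroup.zpowers g) (by simpa using hg)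
  have hker : (QuotientGroup.mk' (frattini G)).ker ≤ L := by
    rw [QuotientGroup.ker_mk']; exact frattini_le_coatom hL
  have hback := Subgroup.comap_map_eq_self hker
  have hL' : IsCoatom (L.map (QuotientGroup.mk' (frattini G))) := by
    refine ⟨fun h => hL.1 ?_, fun K hK => ?_⟩
    · rw [← hback, h, Subgroup.comap_top]
    · have hlt : L < K.comap (QuotientGroup.mk' (frattini G)) := by
        rw [← hback]
        exact (Subgroup.comap_lt_comap_of_surjective (QuotientGroup.mk'_surjective _)).2 hK
      rw [← Subgroup.map_comap_eq_self_of_surjective (QuotientGroup.mk'_surjective _) K,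
        hL.2 _ hlt, Subgroup.map_top_of_surjective _ (QuotientGroup.mk'_surjective _)]
  have hmem : g ∈ (L.map (QuotientGroup.mk' (frattini G))).comap
      (QuotientGroup.mk' (frattini G)) := frattini_le_coatom hL' hx
  rw [hback] at hmem
  exact hgL (by simpa using hmem)

/-- `Φ(N)` is normal in `G`. If a maximal `L` omits it, then `G = Φ(N)L`, so `N = Φ(N)(N ⊓ L)`, and
nongeneration gives `N ≤ L`. -/
theorem map_subtype_frattini_le [Finite G] (N : Subgroup G) [N.Normal] :
    (frattini N).map N.subtype ≤ frattini G := by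
  by_contra hle
  obtain ⟨L, hL, hPL⟩ := exists_isCoatom_not_le hle
  have hn : ((frattini N).map N.subtype).Normal := ConjAct.normal_of_characteristic_of_normal
  have htop : (frattini N).map N.subtype ⊔ L = ⊤ := hL.2 _ (right_lt_sup.2 hPL)
  have hNL : L.subgroupOf N ⊔ frattini N = ⊤ := by
    refine top_le_iff.1 fun x _ => ?_
    have hx : (x : G) ∈ (frattini N).map N.subtype ⊔ L := by rw [htop]; trivial
    obtain ⟨_, ⟨p, hp, rfl⟩, l, hl, hpl⟩ := Subgroup.mem_sup_of_normal_left.1 hx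
    have hl' : p⁻¹ * x ∈ L.subgroupOf N := by
      rw [Subgroup.mem_subgroupOf]
      have : ((p⁻¹ * x : N) : G) = l := by
        rw [Subgroup.coe_mul, ← hpl, Subgroup.coe_inv]; simp
      rwa [this]
    rw [sup_comm]
    simpa using Subgroup.mul_mem_sup hp hl'
  have hNL' : N ≤ L := Subgroup.subgroupOf_eq_top.1 (frattini_nongenerating hNL)
  exact hPL ((Subgroup.map_subtype_le _).trans hNL')

/-! ### The class and the iterated series. -/

theorem forsterClass_iff_socle : ForsterClass G ↔ socle (G ⧸ frattini G) = ⊤ := by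
  rw [ForsterClass, ← map_fTilde]
  refine ⟨fun h => ?_, fun h => ?_⟩
  · rw [h, Subgroup.map_top_of_surjective _ (QuotientGroup.mk'_surjective _)]
  · rw [fTilde, ← map_fTilde, h, Subgroup.comap_top]

theorem forsterClass_iff_isQuasinilpotent [Finite G] :
    ForsterClass G ↔ IsQuasinilpotent (G ⧸ frattini G) := by
  rw [forsterClass_iff_socle]
  exact ⟨fun h => (isCentrallyReducible_of_socle_eq_top h).isQuasinilpotent,
    fun h => h.socle_eq_top frattini_quotient_frattini⟩

theorem ForsterClass.isCentrallyReducible [Finite G] (h : ForsterClass G) :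
    IsCentrallyReducible (G ⧸ frattini G) :=
  isCentrallyReducible_of_socle_eq_top (forsterClass_iff_socle.1 h)

theorem ForsterClass.of_surjective {H : Type u} [Group H] [Finite G] (h : ForsterClass G)
    (f : G →* H) (hf : Function.Surjective f) : ForsterClass H := by
  have : Finite H := Finite.of_surjective f hf
  rw [forsterClass_iff_isQuasinilpotent]
  refine (h.isCentrallyReducible.of_surjective (QuotientGroup.map (frattini G) (frattini H) f
    (frattini_le_comap_frattini_of_surjective hf)) ?_).isQuasinilpotent
  exact QuotientGroup.map_surjective_of_surjective _ _ _
    ((QuotientGroup.mk'_surjective _).comp hf) _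

theorem ForsterClass.le_fTilde [Finite G] {N : Subgroup G} (hN : N.Normal)
    (h : ForsterClass N) : N ≤ fTilde G := by
  set π := QuotientGroup.mk' (frattini G)
  let f : N ⧸ frattini N →* G ⧸ frattini G :=
    QuotientGroup.lift (frattini N) (π.comp N.subtype) fun x hx =>
      (QuotientGroup.eq_one_iff (x : G)).2 (map_subtype_frattini_le N ⟨x, hx, rfl⟩)
  have hrange : f.range = N.map π := by
    ext y
    constructor
    · rintro ⟨x, rfl⟩
      obtain ⟨n, rfl⟩ := QuotientGroup.mk'_surjective (frattini N) x
      exact ⟨n, n.2, rfl⟩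
    · rintro ⟨n, hn, rfl⟩
      exact ⟨QuotientGroup.mk' (frattini N) ⟨n, hn⟩, rfl⟩
  have hMn : (N.map π).Normal := hN.map π (QuotientGroup.mk'_surjective _)
  rw [fTilde, ← Subgroup.map_le_iff_le_comap]
  refine le_socle_of_frattini_eq_bot frattini_quotient_frattini hMn ?_
  have := h.isCentrallyReducible.range_le f
    (T := N.map π ⊓ socle (G ⧸ frattini G)) inferInstance (hrange ▸ inf_le_left)
  rwa [hrange] at this

theorem ForsterClass.le_fTildeIter [Finite G] {N : Subgroup G} (hN : N.Normal)
    (h : ForsterClass N) (n : ℕ) : N ≤ fTildeIter G n := by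
  induction n with
  | zero => exact le_top
  | succ n ih =>
    have e := (Subgroup.subgroupOfEquivOfLe ih).symm
    have hle := (h.of_surjective e.toMonoidHom e.surjective).le_fTilde
      (hN.subgroupOf (fTildeIter G n))
    rw [← Subgroup.map_subgroupOf_eq_of_le ih]
    exact Subgroup.map_mono hle

theorem forsterClass_fTildeInf [Finite G] : ForsterClass (fTildeInf G) := by
  obtain ⟨n, hn⟩ := exists_fTildeInf_eq G
  -- The series is stationary from `n` on, so `F̃` fixes its `n`-th term.
  have hle : fTildeIter G n ≤ fTildeIter G (n + 1) := hn ▸ iInf_le _ (n + 1)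
  rw [hn]
  refine top_le_iff.1 fun x _ => ?_
  obtain ⟨y, hy, hyx⟩ := hle x.2
  rwa [← Subtype.ext hyx]

theorem fTildeInf_normal : (fTildeInf G).Normal :=
  Subgroup.normal_iInf_normal fun n => fTildeIter_normal n

theorem isGreatest_fTildeInf [Finite G] :
    IsGreatest {N : Subgroup G | N.Normal ∧ ForsterClass N} (fTildeInf G) :=
  ⟨⟨fTildeInf_normal, forsterClass_fTildeInf⟩,
    fun _ hN => le_iInf fun n => hN.2.le_fTildeIter hN.1 n⟩

end Auxiliary

end GenFitting

theorem proposition5p2 (G : Type u) [Group G] [Finite G] :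
    GenFitting.classRadical (fun H _ => GenFitting.ForsterClass H) G = GenFitting.fTildeInf G ∧
    IsGreatest {N : Subgroup G | N.Normal ∧ GenFitting.ForsterClass N}
      (GenFitting.fTildeInf G) ∧
    IsGreatest {N : Subgroup G | N.Normal ∧ GenFitting.IsQuasinilpotent (N ⧸ frattini N)}
      (GenFitting.fTildeInf G) := by
  refine ⟨GenFitting.isGreatest_fTildeInf.isLUB.sSup_eq, GenFitting.isGreatest_fTildeInf, ?_⟩
  simpa only [GenFitting.forsterClass_iff_isQuasinilpotent] using
    GenFitting.isGreatest_fTildeInf (G := G)
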